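/- Let $G$ be a group with a finite symmetric generating subset $S$, and let $H$ be a normal subgroup of $G$ such that the pair $(G,H)$ has relative Property T, i.e. for every orthogonal representation $\pi$ of $G$ on a real Hilbert space and every sequence of unit vectors $(v_n)$ with $\|\pi(g)v_n-v_n\|\to 0$ for every $g\in G$, one has $\sup_{h\in H}\|\pi(h)v_n-v_n\|\to 0$. Let $X$ be a (real or complex) Banach space which is uniformly curved, i.e. there is a function $\Delta_X$ with $\Delta_X(\varepsilon)\to 0$ as $\varepsilon\to 0^+$ such that, for every measure space $(\Omega,\mu)$, every $\varepsilon>0$ and every bounded operator $T$ on $L^2(\Omega,\mu)$ (scalars those of $X$) with $\|T\|\le\varepsilon$ that is simultaneously of norm $\le 1$ for the $L^1$-norm and for the $L^\infty$-norm, the operator $T\otimes \mathrm{Id}_X$ extends to a bounded operator of norm $\le\Delta_X(\varepsilon)$ on $L^2(\Omega,\mu,X)$. Then there exist $C>0$ and an integer $n_0\ge 1$ such that for every finite quotient $q\colon G\twoheadrightarrow Q$ and every function $f\colon Q\to X$, $$\sum_{g\in Q}\|M_{q(H)}f(g)-f(g)\|^2\le C\sum_{g\in Q}\|M_S^{n_0}f(g)-f(g)\|^2,$$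 where $M_{q(H)}f(g)=\frac1{|q(H)|}\sum_{a\in q(H)}f(ga)$ and $M_Sf(g)=\frac1{|S|}\sum_{s\in S}f(g\,q(s))$; and moreover, with the same constants, for every $h\in H$ and every $f\colon Q\to X$, $$\sum_{g\in Q}\|f(g\,q(h))-f(g)\|^2\le (2n_0)^2\,C\sum_{g\in Q}\sum_{s\in S}\|f(g\,q(s))-f(g)\|^2 .$$ -/

import Mathlib

open MeasureTheory Filter Topology
open scoped ENNReal

/-- `averageOp 𝕜 φ A f g = (1 / |A|) * ∑_{a ∈ A} f (g φ(a))`: the averaging operator over right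
translations by the elements `φ a`, `a ∈ A`. For `φ = id` this is the usual operator `M_A` on
functions on `Q`; for a finite subset `A` of `G` and a homomorphism `φ : G → Q` it is the
operator `M_A` acting on functions on the quotient `Q`. -/
noncomputable def averageOp (𝕜 : Type*) [RCLike 𝕜] {α Q X : Type*} [Group Q]
    [NormedAddCommGroup X] [NormedSpace 𝕜 X]
    (φ : α → Q) (A : Finset α) (f : Q → X) : Q → X :=
  fun g => (A.card : 𝕜)⁻¹ • ∑ a ∈ A, f (g * φ a)

/-- Relative Property T of the pair `(G, Y)`: for every orthogonal representation `π` of `G` in a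
real Hilbert space and every sequence of unit vectors `v n` with `‖π g (v n) - v n‖ → 0` for every
`g : G`, this convergence is uniform on `Y`. (For a countable group, Hilbert spaces in `Type`
suffice: an almost invariant sequence lies in a separable invariant closed subspace.) -/
def HasRelativePropertyT (G : Type*) [Group G] (Y : Set G) : Prop :=
  ∀ (E : Type) [NormedAddCommGroup E] [InnerProductSpace ℝ E] [CompleteSpace E]
    (π : G →* (E ≃ₗᵢ[ℝ] E)) (v : ℕ → E),
    (∀ n, ‖v n‖ = 1) →
    (∀ g : G, Tendsto (fun n => ‖π g (v n) - v n‖) atTop (𝓝 0)) →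
    TendstoUniformlyOn (fun n g => ‖π g (v n) - v n‖) (fun _ => 0) atTop Y

/-- The elementary tensor `f ⊗ x`, i.e. the class of `ω ↦ f ω • x`, in `L²(Ω, μ, X)`. -/
noncomputable def lpTensor {𝕜 : Type*} [RCLike 𝕜] {X : Type*} [NormedAddCommGroup X]
    [NormedSpace 𝕜 X] {Ω : Type*} [MeasurableSpace Ω] {μ : Measure Ω}
    (f : Lp 𝕜 2 μ) (x : X) : Lp X 2 μ :=
  (ContinuousLinearMap.toSpanSingleton 𝕜 x).compLp f

/-- `X` is uniformly curved: there is a function `Δ` with `Δ ε → 0` as `ε → 0⁺` such that for every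
measure space, every operator `T` on `L²(Ω, μ)` with `‖T‖ ≤ ε` which is contractive for the `L¹`
and for the `L^∞` norm extends to an operator `T ⊗ Id_X` of norm at most `Δ ε` on `L²(Ω, μ, X)`.
(The extension is unique, as the elementary tensors span a dense subspace.) -/
def IsUniformlyCurved (𝕜 : Type*) [RCLike 𝕜] (X : Type*) [NormedAddCommGroup X]
    [NormedSpace 𝕜 X] : Prop :=
  ∃ Δ : ℝ → ℝ, Tendsto Δ (𝓝[>] 0) (𝓝 0) ∧
    ∀ (Ω : Type) [MeasurableSpace Ω] (μ : Measure Ω) (T : Lp 𝕜 2 μ →L[𝕜] Lp 𝕜 2 μ) (ε : ℝ),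
      0 < ε → ‖T‖ ≤ ε →
      (∀ f : Lp 𝕜 2 μ, eLpNorm (T f) 1 μ ≤ eLpNorm f 1 μ) →
      (∀ f : Lp 𝕜 2 μ, eLpNorm (T f) ∞ μ ≤ eLpNorm f ∞ μ) →
      ∃ TX : Lp X 2 μ →L[𝕜] Lp X 2 μ,
        (∀ (f : Lp 𝕜 2 μ) (x : X), TX (lpTensor f x) = lpTensor (T f) x) ∧ ‖TX‖ ≤ Δ ε

/-! Let `P` be the mean over `q(H)` and `B = (1 + M_S) / 2` the lazy average. The proof first finds
a contraction of `B` on scalar functions, then lets uniform curvature carry it to `X`.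

Scalar side: a Hilbert sum of counterexamples turns relative Property T into one constant valid for
all representations (`HasRelativePropertyT.exists_forall_norm_sub_lt_one`). Applied to regular
representations, it bounds below the displacement by `S` of functions in `ker P`. The parallelogram
law then gives a uniform `c < 1` with `‖B v‖ ≤ c ‖v‖` on `ker P`
(`HasRelativePropertyT.exists_norm_lazy_meanOp_le`). Laziness is needed because `M_S` may have
eigenvalue `-1` there.

Vector side: `P` commutes with `B` because `H` is normal, so `Bⁿ (1 - P) / 2` has `L²` norm at most
`cⁿ`, while it contracts `L¹` and `L^∞`. Uniform curvature makes its `X`-valued version small for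
some `n` independent of `Q`. Telescoping the powers of `B` gives `‖P f - f‖ ≤ 2n ‖M_S f - f‖`
(`norm_proj_sub_le`). The power `n` thus enters only the constant, and the final exponent is `1`. -/

/-! ### Hilbert sums and a uniform form of relative Property T -/

/-- A family of linear isometric automorphisms acts diagonally on the Hilbert sum. -/
noncomputable def lpDiagonal {ι : Type*} {E : ι → Type*} [∀ i, NormedAddCommGroup (E i)]
    [∀ i, NormedSpace ℝ (E i)] (e : ∀ i, E i ≃ₗᵢ[ℝ] E i) : lp E 2 ≃ₗᵢ[ℝ] lp E 2 where
  toFun f := ⟨fun i => e i (f i), by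
    have := (lp.memℓp f).norm
    exact memℓp_norm_iff.1 (by simpa using this)⟩
  invFun f := ⟨fun i => (e i).symm (f i), by
    have := (lp.memℓp f).norm
    exact memℓp_norm_iff.1 (by simpa using this)⟩
  map_add' f g := by ext i; exact map_add (e i) (f i) (g i)
  map_smul' c f := by ext i; exact map_smul (e i) c (f i)
  left_inv f := by ext i; simp
  right_inv f := by ext i; simp
  norm_map' f := by
    have h2 : 0 < (2 : ℝ≥0∞).toReal := by norm_num
    rw [lp.norm_eq_tsum_rpow h2, lp.norm_eq_tsum_rpow h2]
    simp

@[simp]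
theorem lpDiagonal_apply {ι : Type*} {E : ι → Type*} [∀ i, NormedAddCommGroup (E i)]
    [∀ i, NormedSpace ℝ (E i)] (e : ∀ i, E i ≃ₗᵢ[ℝ] E i) (f : lp E 2) (i : ι) :
    lpDiagonal e f i = e i (f i) := rfl

theorem lpDiagonal_single {ι : Type*} [DecidableEq ι] {E : ι → Type*}
    [∀ i, NormedAddCommGroup (E i)] [∀ i, NormedSpace ℝ (E i)] (e : ∀ i, E i ≃ₗᵢ[ℝ] E i)
    (i : ι) (v : E i) : lpDiagonal e (lp.single 2 i v) = lp.single 2 i (e i v) := by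
  ext j
  rw [lpDiagonal_apply, lp.single_apply, lp.single_apply]
  by_cases h : j = i
  · subst h; simp
  · simp [h]

/-- The Hilbert sum of a family of orthogonal representations. -/
noncomputable def hilbertSumRep {G ι : Type*} [Group G] {E : ι → Type*}
    [∀ i, NormedAddCommGroup (E i)] [∀ i, NormedSpace ℝ (E i)]
    (π : ∀ i, G →* (E i ≃ₗᵢ[ℝ] E i)) : G →* (lp E 2 ≃ₗᵢ[ℝ] lp E 2) where
  toFun g := lpDiagonal fun i => π i g
  map_one' := by ext f i; simp
  map_mul' g h := by ext f i; simp

theorem hilbertSumRep_single {G ι : Type*} [Group G] [DecidableEq ι] {E : ι → Type*}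
    [∀ i, NormedAddCommGroup (E i)] [∀ i, NormedSpace ℝ (E i)]
    (π : ∀ i, G →* (E i ≃ₗᵢ[ℝ] E i)) (g : G) (i : ι) (v : E i) :
    hilbertSumRep π g (lp.single 2 i v) = lp.single 2 i (π i g v) :=
  lpDiagonal_single _ i v

/-- Almost invariance under a generating set implies almost invariance under each element. -/
theorem tendsto_norm_sub_of_closure_eq_top {G : Type*} [Group G] {S : Set G}
    (hS : Subgroup.closure S = ⊤) {E : Type*} [NormedAddCommGroup E] [NormedSpace ℝ E]
    (π : G →* (E ≃ₗᵢ[ℝ] E)) (v : ℕ → E)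
    (h : ∀ s ∈ S, Tendsto (fun n => ‖π s (v n) - v n‖) atTop (𝓝 0)) (g : G) :
    Tendsto (fun n => ‖π g (v n) - v n‖) atTop (𝓝 0) := by
  have hg : g ∈ Subgroup.closure S := hS ▸ Subgroup.mem_top g
  induction hg using Subgroup.closure_induction with
  | mem x hx => exact h x hx
  | one => simp
  | mul x y _ _ hx hy =>
    refine squeeze_zero (fun _ => norm_nonneg _) (fun n => ?_) (by simpa using hy.add hx)
    rw [map_mul, ← (π x).norm_map (π y (v n) - v n), map_sub]
    simpa using norm_sub_le_norm_sub_add_norm_sub (π x (π y (v n))) (π x (v n)) (v n)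
  | inv x _ hx =>
    refine hx.congr fun n => ?_
    rw [← (π x).norm_map (π x⁻¹ (v n) - v n), map_sub, norm_sub_rev]
    congr 2
    change v n = (π x * π x⁻¹) (v n)
    rw [← map_mul, mul_inv_cancel, map_one]
    rfl

/-- Relative Property T with a uniform constant: vectors which are sufficiently invariant under a
finite generating set are moved by less than `1` by all of `Y`, in every orthogonal
representation. -/
theorem HasRelativePropertyT.exists_forall_norm_sub_lt_one {G : Type*} [Group G] {Y : Set G}
    (hT : HasRelativePropertyT G Y) {S : Set G} (hS : Subgroup.closure S = ⊤) :
    ∃ δ : ℝ, 0 < δ ∧ ∀ (E : Type) [NormedAddCommGroup E] [InnerProductSpace ℝ E]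
      [CompleteSpace E] (π : G →* (E ≃ₗᵢ[ℝ] E)) (v : E), ‖v‖ = 1 →
      (∀ s ∈ S, ‖π s v - v‖ < δ) → ∀ h ∈ Y, ‖π h v - v‖ < 1 := by
  -- A counterexample for each `δ = 1 / (n + 1)` is placed in its own summand of one Hilbert sum.
  -- The resulting sequence is almost invariant, yet its `n`-th vector is moved by at least `1` by
  -- some element of `Y`, against uniform convergence.
  by_contra! hcon
  have hpos (n : ℕ) : (0 : ℝ) < 1 / ((n : ℝ) + 1) := Nat.one_div_pos_of_nat
  choose E i₁ i₂ i₃ π v hv hS' h hY hh using fun n : ℕ => hcon _ (hpos n)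
  have key : ∀ (g : G) (n : ℕ),
      ‖hilbertSumRep π g (lp.single 2 n (v n)) - lp.single 2 n (v n)‖ = ‖π n g (v n) - v n‖ := by
    intro g n
    rw [hilbertSumRep_single, ← lp.single_sub, lp.norm_single (by norm_num)]
  have hunif := hT (lp E 2) (hilbertSumRep π) (fun n => lp.single 2 n (v n))
    (fun n => by rw [lp.norm_single (by norm_num), hv])
    (tendsto_norm_sub_of_closure_eq_top hS _ _ fun s hs => by
      simp only [key]
      exact squeeze_zero (fun _ => norm_nonneg _) (fun n => (hS' n s hs).le)
        tendsto_one_div_add_atTop_nhds_zero_nat)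
  obtain ⟨n, hn⟩ := (Metric.tendstoUniformlyOn_iff.1 hunif 1 one_pos).exists
  have := hn (h n) (hY n)
  simp only [key, dist_zero_left, norm_norm] at this
  exact absurd (hh n) (not_le.2 this)

/-! ### Spectral gap for scalar functions on finite quotients -/

/-- The right regular representation of `G` on `ℓ²(Q)`, for a homomorphism `q : G → Q`. -/
noncomputable def rightRegularRep {G Q : Type*} [Group G] [Group Q] [Fintype Q] (q : G →* Q) :
    G →* (EuclideanSpace ℝ Q ≃ₗᵢ[ℝ] EuclideanSpace ℝ Q) where
  -- Transport along an equivalence precomposes with its inverse, hence the inverse of `q g` here.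
  toFun g := LinearIsometryEquiv.piLpCongrLeft 2 ℝ ℝ (Equiv.mulRight (q g)⁻¹)
  map_one' := by
    ext f x
    change f (x * (q 1)⁻¹⁻¹) = f x
    simp
  map_mul' g h := by
    ext f x
    change f (x * (q (g * h))⁻¹⁻¹) = f (x * (q g)⁻¹⁻¹ * (q h)⁻¹⁻¹)
    simp [mul_assoc]

theorem rightRegularRep_apply {G Q : Type*} [Group G] [Group Q] [Fintype Q] (q : G →* Q)
    (g : G) (v : EuclideanSpace ℝ Q) (x : Q) : rightRegularRep q g v x = v (x * q g) := by
  change v (x * (q g)⁻¹⁻¹) = _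
  rw [inv_inv]

/-- Relative Property T gives a spectral gap, uniform over all finite quotients, for real functions
without `N`-invariant part. -/
theorem HasRelativePropertyT.exists_spectralGap_real {G : Type*} [Group G] {Y : Set G}
    (hT : HasRelativePropertyT G Y) (S : Finset G) (hS : Subgroup.closure (S : Set G) = ⊤) :
    ∃ δ : ℝ, 0 < δ ∧ ∀ (Q : Type) [Group Q] [Fintype Q] (q : G →* Q) (N : Finset Q),
      N.Nonempty → (N : Set Q) = q '' Y → ∀ f : Q → ℝ, (∀ x, ∑ a ∈ N, f (x * a) = 0) →
      δ * ∑ x, f x ^ 2 ≤ ∑ s ∈ S, ∑ x, (f (x * q s) - f x) ^ 2 := by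
  obtain ⟨δ, hδ, h⟩ := hT.exists_forall_norm_sub_lt_one hS
  refine ⟨δ ^ 2, by positivity, fun Q _ _ q N hN hNY f hf => ?_⟩
  by_contra! hlt
  set v : EuclideanSpace ℝ Q := WithLp.toLp 2 f with hv
  have hsq (g : G) : ‖rightRegularRep q g v - v‖ ^ 2 = ∑ x, (f (x * q g) - f x) ^ 2 := by
    simp [EuclideanSpace.norm_sq_eq, rightRegularRep_apply, hv]
  have hvsq : ‖v‖ ^ 2 = ∑ x, f x ^ 2 := by simp [EuclideanSpace.norm_sq_eq, hv]
  have hv0 : v ≠ 0 := by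
    intro h0
    rw [← hvsq, h0] at hlt
    simp only [norm_zero] at hlt
    have : 0 ≤ ∑ s ∈ S, ∑ x, (f (x * q s) - f x) ^ 2 := by positivity
    linarith
  have hvpos : 0 < ‖v‖ := norm_pos_iff.2 hv0
  have hscale (g : G) : ‖rightRegularRep q g (‖v‖⁻¹ • v) - ‖v‖⁻¹ • v‖
      = ‖v‖⁻¹ * ‖rightRegularRep q g v - v‖ := by
    rw [map_smul, ← smul_sub, norm_smul, norm_inv, norm_norm]
  have hlt1 : ∀ y ∈ Y, ‖rightRegularRep q y v - v‖ < ‖v‖ := by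
    intro y hy
    have := h _ (rightRegularRep q) (‖v‖⁻¹ • v)
      (by rw [norm_smul, norm_inv, norm_norm, inv_mul_cancel₀ hvpos.ne']) (fun s hs => ?_) y hy
    · rw [hscale, inv_mul_lt_iff₀ hvpos, mul_one] at this
      exact this
    · rw [hscale, inv_mul_lt_iff₀ hvpos]
      refine lt_of_pow_lt_pow_left₀ 2 (by positivity) ?_
      rw [hsq, mul_pow, hvsq, mul_comm]
      refine lt_of_le_of_lt ?_ hlt
      exact Finset.single_le_sum (f := fun s => ∑ x, (f (x * q s) - f x) ^ 2)
        (fun s _ => by positivity) hs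
  -- Since `f` has mean zero on the cosets of `N`, the displacements of `v` by the elements of `N`
  -- sum to `-|N| v`. This is impossible if each is shorter than `v`.
  have hsum : ∑ a ∈ N, ‖(WithLp.toLp 2 fun x => f (x * a) - f x : EuclideanSpace ℝ Q)‖
      < ∑ a ∈ N, ‖v‖ := by
    refine Finset.sum_lt_sum_of_nonempty hN fun a ha => ?_
    obtain ⟨y, hy, rfl⟩ : a ∈ q '' Y := hNY ▸ ha
    have heq : (WithLp.toLp 2 fun x => f (x * q y) - f x : EuclideanSpace ℝ Q)
        = rightRegularRep q y v - v := by
      ext x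
      simp [rightRegularRep_apply, hv]
    rw [heq]
    exact hlt1 y hy
  have hle := (norm_sum_le N _).trans_lt hsum
  have : ∑ a ∈ N, (WithLp.toLp 2 fun x => f (x * a) - f x : EuclideanSpace ℝ Q)
      = -((N.card : ℝ) • v) := by
    ext x
    simp [hv, hf]
  rw [this, norm_neg, norm_smul, Finset.sum_const, nsmul_eq_mul] at hle
  simp at hle

theorem RCLike.sum_norm_sq_eq {𝕜 ι : Type*} [RCLike 𝕜] (s : Finset ι) (f : ι → 𝕜) :
    ∑ i ∈ s, ‖f i‖ ^ 2 = ∑ i ∈ s, RCLike.re (f i) ^ 2 + ∑ i ∈ s, RCLike.im (f i) ^ 2 := by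
  simp_rw [← Finset.sum_add_distrib, RCLike.norm_sq_eq_def, sq]

/-- Both sides split as sums over real and imaginary parts, so the real constant serves for every
scalar field. -/
theorem HasRelativePropertyT.exists_spectralGap {G : Type*} [Group G] {Y : Set G}
    (hT : HasRelativePropertyT G Y) (S : Finset G) (hS : Subgroup.closure (S : Set G) = ⊤)
    (𝕜 : Type*) [RCLike 𝕜] :
    ∃ δ : ℝ, 0 < δ ∧ ∀ (Q : Type) [Group Q] [Fintype Q] (q : G →* Q) (N : Finset Q),
      N.Nonempty → (N : Set Q) = q '' Y → ∀ f : Q → 𝕜, (∀ x, ∑ a ∈ N, f (x * a) = 0) →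
      δ * ∑ x, ‖f x‖ ^ 2 ≤ ∑ s ∈ S, ∑ x, ‖f (x * q s) - f x‖ ^ 2 := by
  obtain ⟨δ, hδ, h⟩ := hT.exists_spectralGap_real S hS
  refine ⟨δ, hδ, fun Q _ _ q N hN hNY f hf => ?_⟩
  have h₁ := h Q q N hN hNY (fun x => RCLike.re (f x)) fun x => by
    rw [← map_sum, hf, map_zero]
  have h₂ := h Q q N hN hNY (fun x => RCLike.im (f x)) fun x => by
    rw [← map_sum, hf, map_zero]
  simp_rw [RCLike.sum_norm_sq_eq, Finset.sum_add_distrib, map_sub, mul_add]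
  exact add_le_add h₁ h₂

/-! ### Norm estimates for contractions and commuting projections -/

/-- A contraction satisfies `‖u - Bⁿ u‖ ≤ n ‖u - B u‖`. -/
theorem norm_sub_pow_apply_le {𝕜 E : Type*} [RCLike 𝕜] [NormedAddCommGroup E] [NormedSpace 𝕜 E]
    {B : E →L[𝕜] E} (hB : ‖B‖ ≤ 1) (u : E) (n : ℕ) : ‖u - (B ^ n) u‖ ≤ n * ‖u - B u‖ := by
  induction n with
  | zero => simp
  | succ n ih =>
    have h : ‖B (u - (B ^ n) u)‖ ≤ ‖u - (B ^ n) u‖ := by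
      simpa using B.le_of_opNorm_le hB (u - (B ^ n) u)
    have hp : (B ^ (n + 1)) u = B ((B ^ n) u) := by rw [pow_succ']; rfl
    calc ‖u - (B ^ (n + 1)) u‖ = ‖(u - B u) + B (u - (B ^ n) u)‖ := by
          rw [hp, map_sub]; congr 1; abel
      _ ≤ ‖u - B u‖ + ‖u - (B ^ n) u‖ := (norm_add_le _ _).trans (add_le_add le_rfl h)
      _ ≤ ((n + 1 : ℕ) : ℝ) * ‖u - B u‖ := by rw [Nat.cast_succ]; linarith

/-- If the powers of `(1 + A) / 2` become small on the range of the complement of a projection `P`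
commuting with `A`, then `A` almost fixes only vectors which `P` almost fixes. -/
theorem norm_proj_sub_le {𝕜 E : Type*} [RCLike 𝕜] [NormedAddCommGroup E] [NormedSpace 𝕜 E]
    {A P : E →L[𝕜] E} (hA : ‖A‖ ≤ 1) (hP : ‖P‖ ≤ 1) (hPP : P * P = P) (hAP : Commute A P) {n : ℕ}
    (h : ‖((2 : 𝕜)⁻¹ • (1 + A)) ^ n * (1 - P)‖ ≤ 1 / 2) (f : E) :
    ‖P f - f‖ ≤ 2 * n * ‖A f - f‖ := by
  set B : E →L[𝕜] E := (2 : 𝕜)⁻¹ • (1 + A) with hBdef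
  have h2 : ‖(2 : 𝕜)⁻¹‖ = 1 / 2 := by simp
  have hone : ‖(1 : E →L[𝕜] E)‖ ≤ 1 := ContinuousLinearMap.norm_id_le
  have hB : ‖B‖ ≤ 1 := by
    rw [hBdef, norm_smul, h2]
    linarith [norm_add_le 1 A]
  have hBsub (u : E) : ‖u - B u‖ = 1 / 2 * ‖A u - u‖ := by
    have : u - B u = (2 : 𝕜)⁻¹ • (u - A u) := by
      have h3 : u = (2 : 𝕜)⁻¹ • (u + u) := by
        rw [← two_smul 𝕜 u, smul_smul, inv_mul_cancel₀ two_ne_zero, one_smul]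
      have h4 : B u = (2 : 𝕜)⁻¹ • (u + A u) := rfl
      rw [h4]
      nth_rewrite 1 [h3]
      rw [← smul_sub]
      congr 1
      abel
    rw [this, norm_smul, h2, norm_sub_rev]
  set u := (1 - P) f with hu
  have huP : (1 - P) u = u := by
    have : (1 - P) * (1 - P) = 1 - P := by
      rw [mul_sub, sub_mul, sub_mul, hPP]; simp
    exact congr($this f)
  have hc : Commute A (1 - P) := (Commute.one_right A).sub_right hAP
  have h₁ : ‖(B ^ n) u‖ ≤ 1 / 2 * ‖u‖ := by
    have := (B ^ n * (1 - P)).le_of_opNorm_le h u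
    rwa [mul_apply_eq_comp, huP] at this
  have h₂ : ‖A u - u‖ ≤ 2 * ‖A f - f‖ := by
    have h3 : A u - u = (1 - P) (A f - f) := by
      have : A ((1 - P) f) = (1 - P) (A f) := congr($(hc.eq) f)
      rw [map_sub, hu, this]
    rw [h3]
    refine (1 - P).le_of_opNorm_le ?_ _
    linarith [norm_sub_le 1 P]
  -- The bounds combine to `‖u‖ ≤ n ‖A f - f‖ + ‖u‖ / 2`; the last term is absorbed on the left.
  have h₃ := norm_sub_pow_apply_le hB u n
  rw [hBsub] at h₃
  have h₄ : ‖u‖ ≤ ‖u - (B ^ n) u‖ + ‖(B ^ n) u‖ := by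
    simpa using norm_add_le (u - (B ^ n) u) ((B ^ n) u)
  have h₅ : ‖P f - f‖ = ‖u‖ := by
    rw [norm_sub_rev]; rfl
  have h₆ : (n : ℝ) * (1 / 2 * ‖A u - u‖) ≤ n * ‖A f - f‖ := by gcongr; linarith
  linarith

/-- If `B` contracts the invariant subspace `ker P` by the factor `c`, then `Bⁿ (1 - P)` has norm at
most `2 cⁿ`. -/
theorem norm_pow_mul_one_sub_le {𝕜 E : Type*} [RCLike 𝕜] [NormedAddCommGroup E] [NormedSpace 𝕜 E]
    {B P : E →L[𝕜] E} (hP : ‖P‖ ≤ 1) (hPP : P * P = P) (hBP : Commute B P) {c : ℝ} (hc : 0 ≤ c)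
    (h : ∀ v, P v = 0 → ‖B v‖ ≤ c * ‖v‖) (n : ℕ) : ‖B ^ n * (1 - P)‖ ≤ 2 * c ^ n := by
  refine ContinuousLinearMap.opNorm_le_bound _ (by positivity) fun f => ?_
  have hker (n : ℕ) (v : E) (hv : P v = 0) : P ((B ^ n) v) = 0 := by
    have : P ((B ^ n) v) = (B ^ n) (P v) := congr($((hBP.pow_left n).eq.symm) v)
    rw [this, hv, map_zero]
  have hn (n : ℕ) (v : E) (hv : P v = 0) : ‖(B ^ n) v‖ ≤ c ^ n * ‖v‖ := by
    induction n with
    | zero => simp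
    | succ n ih =>
      calc ‖(B ^ (n + 1)) v‖ = ‖B ((B ^ n) v)‖ := by rw [pow_succ']; rfl
        _ ≤ c * ‖(B ^ n) v‖ := h _ (hker n v hv)
        _ ≤ c * (c ^ n * ‖v‖) := by gcongr
        _ = c ^ (n + 1) * ‖v‖ := by ring
  have h0 : P ((1 - P) f) = 0 := by
    have : P * (1 - P) = 0 := by rw [mul_sub, hPP, mul_one, sub_self]
    exact congr($this f)
  have hone : ‖(1 : E →L[𝕜] E)‖ ≤ 1 := ContinuousLinearMap.norm_id_le
  have h1 : ‖(1 - P) f‖ ≤ 2 * ‖f‖ := (1 - P).le_of_opNorm_le (by linarith [norm_sub_le 1 P]) f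
  calc ‖(B ^ n * (1 - P)) f‖ = ‖(B ^ n) ((1 - P) f)‖ := rfl
    _ ≤ c ^ n * ‖(1 - P) f‖ := hn n _ h0
    _ ≤ c ^ n * (2 * ‖f‖) := by gcongr
    _ = 2 * c ^ n * ‖f‖ := by ring

/-- The average of `(v + w s) / 2` is shorter than `v` by a definite factor when the vectors `w s`, of
the same norm as `v`, are not all close to `v`. -/
theorem norm_half_add_mean_sq_le {𝕜 E ι : Type*} [RCLike 𝕜] [NormedAddCommGroup E]
    [InnerProductSpace 𝕜 E] {S : Finset ι} (hS : S.Nonempty) (v : E) (w : ι → E)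
    (hw : ∀ s ∈ S, ‖w s‖ = ‖v‖) {δ : ℝ} (h : δ * ‖v‖ ^ 2 ≤ ∑ s ∈ S, ‖w s - v‖ ^ 2) :
    ‖(2 : 𝕜)⁻¹ • (v + (S.card : 𝕜)⁻¹ • ∑ s ∈ S, w s)‖ ^ 2
      ≤ (1 - δ / (4 * S.card)) * ‖v‖ ^ 2 := by
  have hk : (0 : ℝ) < S.card := by exact_mod_cast hS.card_pos
  have hk' : (S.card : 𝕜) ≠ 0 := by exact_mod_cast hS.card_pos.ne'
  have heq : (2 : 𝕜)⁻¹ • (v + (S.card : 𝕜)⁻¹ • ∑ s ∈ S, w s)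
      = ((2 : 𝕜)⁻¹ * (S.card : 𝕜)⁻¹) • ∑ s ∈ S, (w s + v) := by
    rw [Finset.sum_add_distrib, Finset.sum_const, ← Nat.cast_smul_eq_nsmul 𝕜, mul_smul, smul_add (S.card : 𝕜)⁻¹,
      smul_smul (S.card : 𝕜)⁻¹, inv_mul_cancel₀ hk', one_smul, add_comm]
  have hsq : ‖∑ s ∈ S, (w s + v)‖ ^ 2 ≤ S.card * ∑ s ∈ S, ‖w s + v‖ ^ 2 :=
    (pow_le_pow_left₀ (norm_nonneg _) (norm_sum_le _ _) 2).trans sq_sum_le_card_mul_sum_sq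
  -- Parallelogram law: as `‖w s‖ = ‖v‖`, displacement of `w s` from `v` is exactly what `w s + v`
  -- loses in squared length.
  have hpar : ∑ s ∈ S, ‖w s + v‖ ^ 2 = 4 * S.card * ‖v‖ ^ 2 - ∑ s ∈ S, ‖w s - v‖ ^ 2 := by
    rw [eq_sub_iff_add_eq, ← Finset.sum_add_distrib, Finset.sum_congr rfl fun s hs => ?_,
      Finset.sum_const, nsmul_eq_mul, mul_comm 4, mul_assoc]
    have := parallelogram_law_with_norm 𝕜 (w s) v
    rw [hw s hs] at this
    linarith
  have hnorm : ‖(2 : 𝕜)⁻¹ * (S.card : 𝕜)⁻¹‖ = (2 * (S.card : ℝ))⁻¹ := by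
    simp [mul_comm]
  rw [heq, norm_smul, hnorm, mul_pow]
  calc ((2 * (S.card : ℝ))⁻¹) ^ 2 * ‖∑ s ∈ S, (w s + v)‖ ^ 2
      ≤ ((2 * (S.card : ℝ))⁻¹) ^ 2 * (S.card * (4 * S.card * ‖v‖ ^ 2 - δ * ‖v‖ ^ 2)) := by
        gcongr
        refine hsq.trans ?_
        rw [hpar]
        gcongr
    _ = (1 - δ / (4 * S.card)) * ‖v‖ ^ 2 := by field_simp; ring

/-! ### Counting measure and tensor extensions of operators -/

theorem measurePreserving_mulRight_count {Q : Type*} [Group Q] [MeasurableSpace Q]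
    [DiscreteMeasurableSpace Q] (a : Q) :
    MeasurePreserving (fun x : Q => x * a) Measure.count Measure.count where
  measurable := Measurable.of_discrete
  map_eq := by
    ext s hs
    rw [Measure.map_apply Measurable.of_discrete hs, Measure.count_apply hs,
      Measure.count_apply MeasurableSet.of_discrete,
      Set.encard_preimage_of_bijective (Group.mulRight_bijective a)]

/-- For counting measure only the empty set is null, so almost everywhere statements hold pointwise.
-/
theorem lp_ext_count {Q X : Type*} [MeasurableSpace Q] [MeasurableSingletonClass Q]
    [NormedAddCommGroup X] {p : ℝ≥0∞} {f g : Lp X p (Measure.count : Measure Q)}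
    (h : ∀ x, f x = g x) : f = g :=
  Lp.ext (Eventually.of_forall h)

section TensorExtension

variable {𝕜 : Type*} [RCLike 𝕜] {X : Type*} [NormedAddCommGroup X] [NormedSpace 𝕜 X]
  {Ω : Type*} [MeasurableSpace Ω] {μ : Measure Ω}

/-- `T'` agrees with `T ⊗ Id` on elementary tensors. -/
def ExtendsTensor (T : Lp 𝕜 2 μ →L[𝕜] Lp 𝕜 2 μ) (T' : Lp X 2 μ →L[𝕜] Lp X 2 μ) : Prop :=
  ∀ (f : Lp 𝕜 2 μ) (x : X), T' (lpTensor f x) = lpTensor (T f) x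

theorem lpTensor_add (f g : Lp 𝕜 2 μ) (x : X) :
    lpTensor (f + g) x = lpTensor f x + lpTensor g x :=
  map_add ((ContinuousLinearMap.toSpanSingleton 𝕜 x).compLpₗ 2 μ) f g

theorem lpTensor_smul (c : 𝕜) (f : Lp 𝕜 2 μ) (x : X) : lpTensor (c • f) x = c • lpTensor f x :=
  map_smul ((ContinuousLinearMap.toSpanSingleton 𝕜 x).compLpₗ 2 μ) c f

namespace ExtendsTensor

theorem one : ExtendsTensor (1 : Lp 𝕜 2 μ →L[𝕜] Lp 𝕜 2 μ) (1 : Lp X 2 μ →L[𝕜] Lp X 2 μ) :=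
  fun _ _ => rfl

variable {T U : Lp 𝕜 2 μ →L[𝕜] Lp 𝕜 2 μ} {T' U' : Lp X 2 μ →L[𝕜] Lp X 2 μ}

theorem add (hT : ExtendsTensor T T') (hU : ExtendsTensor U U') :
    ExtendsTensor (T + U) (T' + U') := fun f x => by
  rw [add_apply, add_apply, lpTensor_add, hT, hU]

theorem smul (c : 𝕜) (hT : ExtendsTensor T T') : ExtendsTensor (c • T) (c • T') := fun f x => by
  rw [smul_apply, smul_apply, lpTensor_smul, hT]

theorem sub (hT : ExtendsTensor T T') (hU : ExtendsTensor U U') :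
    ExtendsTensor (T - U) (T' - U') := by
  simpa [sub_eq_add_neg] using hT.add (hU.smul (-1))

theorem mul (hT : ExtendsTensor T T') (hU : ExtendsTensor U U') :
    ExtendsTensor (T * U) (T' * U') := fun f x => by
  rw [mul_apply_eq_comp, mul_apply_eq_comp, hU, hT]

theorem pow (hT : ExtendsTensor T T') (n : ℕ) : ExtendsTensor (T ^ n) (T' ^ n) := by
  induction n with
  | zero => simpa using one
  | succ n ih => rw [pow_succ, pow_succ]; exact ih.mul hT

theorem sum {ι : Type*} (s : Finset ι) {T : ι → Lp 𝕜 2 μ →L[𝕜] Lp 𝕜 2 μ}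
    {T' : ι → Lp X 2 μ →L[𝕜] Lp X 2 μ} (h : ∀ i ∈ s, ExtendsTensor (T i) (T' i)) :
    ExtendsTensor (∑ i ∈ s, T i) (∑ i ∈ s, T' i) := by
  classical
  induction s using Finset.induction_on with
  | empty => intro f x; simpa using (lpTensor_smul (0 : 𝕜) (0 : Lp 𝕜 2 μ) x).symm
  | insert i s hi ih =>
    rw [Finset.sum_insert hi, Finset.sum_insert hi]
    exact (h i (Finset.mem_insert_self i s)).add
      (ih fun j hj => h j (Finset.mem_insert_of_mem hj))

end ExtendsTensor

end TensorExtension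

/-! ### Calculus of bounds in the `Lᵖ` norms -/

section LpBound

variable {𝕜 : Type*} [RCLike 𝕜] {X : Type*} [NormedAddCommGroup X] [NormedSpace 𝕜 X]
  {Ω : Type*} [MeasurableSpace Ω] {μ : Measure Ω}

/-- `T` is bounded by `c` for the `Lᵖ` norm. -/
def LpBound (p c : ℝ≥0∞) (T : Lp X 2 μ →L[𝕜] Lp X 2 μ) : Prop :=
  ∀ f : Lp X 2 μ, eLpNorm (T f) p μ ≤ c * eLpNorm f p μ

namespace LpBound

variable {p c d : ℝ≥0∞} {T U : Lp X 2 μ →L[𝕜] Lp X 2 μ}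

theorem one : LpBound p 1 (1 : Lp X 2 μ →L[𝕜] Lp X 2 μ) := fun f => by simp

theorem add (hp : 1 ≤ p) (hT : LpBound p c T) (hU : LpBound p d U) :
    LpBound p (c + d) (T + U) := fun f => by
  rw [add_apply, eLpNorm_congr_ae (Lp.coeFn_add _ _), add_mul]
  exact (eLpNorm_add_le (Lp.aestronglyMeasurable _) (Lp.aestronglyMeasurable _) hp).trans
    (add_le_add (hT f) (hU f))

theorem smul (a : 𝕜) (hT : LpBound p c T) : LpBound p (‖a‖ₑ * c) (a • T) := fun f => by
  rw [smul_apply, eLpNorm_congr_ae (Lp.coeFn_smul _ _), mul_assoc]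
  exact eLpNorm_const_smul_le.trans (by gcongr; exact hT f)

theorem sub (hp : 1 ≤ p) (hT : LpBound p c T) (hU : LpBound p d U) :
    LpBound p (c + d) (T - U) := by
  simpa [sub_eq_add_neg] using hT.add hp (hU.smul (-1))

theorem mul (hT : LpBound p c T) (hU : LpBound p d U) : LpBound p (c * d) (T * U) := fun f => by
  rw [mul_apply_eq_comp, mul_assoc]
  exact (hT _).trans (by gcongr; exact hU f)

theorem pow (hT : LpBound p c T) (n : ℕ) : LpBound p (c ^ n) (T ^ n) := by
  induction n with
  | zero => simpa using one
  | succ n ih => rw [pow_succ, pow_succ]; exact ih.mul hT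

theorem sum (hp : 1 ≤ p) {ι : Type*} (s : Finset ι) {T : ι → Lp X 2 μ →L[𝕜] Lp X 2 μ}
    (h : ∀ i ∈ s, LpBound p c (T i)) : LpBound p (s.card * c) (∑ i ∈ s, T i) := by
  classical
  induction s using Finset.induction_on with
  | empty => 
    intro f
    have h0 : eLpNorm ((0 : Lp X 2 μ) : Ω → X) p μ = 0 := by
      rw [eLpNorm_congr_ae (Lp.coeFn_zero X 2 μ), eLpNorm_zero]
    simpa using h0
  | insert i s hi ih =>
    rw [Finset.sum_insert hi, Finset.card_insert_of_notMem hi, Nat.cast_succ, add_mul, one_mul,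
      add_comm (_ * c)]
    exact (h i (Finset.mem_insert_self i s)).add hp
      (ih fun j hj => h j (Finset.mem_insert_of_mem hj))

end LpBound

end LpBound

theorem lpTensor_apply {Q : Type*} [MeasurableSpace Q] {𝕜 : Type*} [RCLike 𝕜] {X : Type*}
    [NormedAddCommGroup X] [NormedSpace 𝕜 X]
    (f : Lp 𝕜 2 (Measure.count : Measure Q)) (x : X) (y : Q) :
    lpTensor f x y = f y • x :=
  Measure.ae_count_iff.1 ((ContinuousLinearMap.toSpanSingleton 𝕜 x).coeFn_compLp f) y

theorem sum_lp_count_apply {Q : Type*} [MeasurableSpace Q] {X : Type*} [NormedAddCommGroup X] {ι : Type*}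
    (s : Finset ι) (f : ι → Lp X 2 (Measure.count : Measure Q)) (x : Q) :
    (∑ i ∈ s, f i) x = ∑ i ∈ s, f i x := by
  have := Measure.ae_count_iff.1 (Lp.coeFn_finsetSum s f) x
  simpa using this

/-! ### Functions on a finite set as `L²` elements -/

section Functions

variable {Q : Type*} [Fintype Q] [MeasurableSpace Q] [MeasurableSingletonClass Q]
  {X : Type*} [NormedAddCommGroup X]

/-- A function on a finite set as an element of `L²`. -/
noncomputable def toL2 (f : Q → X) : Lp X 2 (Measure.count : Measure Q) :=
  MemLp.toLp f ⟨AEStronglyMeasurable.of_discrete,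
    eLpNorm_count_lt_top_of_lt fun _ => enorm_lt_top⟩

@[simp]
theorem toL2_apply (f : Q → X) (x : Q) : toL2 f x = f x :=
  Measure.ae_count_iff.1 (MemLp.coeFn_toLp _) x

theorem norm_sq_L2_count (f : Lp X 2 (Measure.count : Measure Q)) :
    ‖f‖ ^ 2 = ∑ x, ‖f x‖ ^ 2 := by
  rw [Lp.norm_def, eLpNorm_eq_lintegral_rpow_enorm_toReal two_ne_zero ENNReal.ofNat_ne_top,
    lintegral_count, tsum_fintype, ← ENNReal.toReal_pow, ← ENNReal.rpow_natCast, ← ENNReal.rpow_mul]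
  simp [ENNReal.toReal_sum]

variable {𝕜 : Type*} [RCLike 𝕜] [NormedSpace 𝕜 X]

theorem eq_sum_lpTensor [DecidableEq Q] (F : Lp X 2 (Measure.count : Measure Q)) :
    F = ∑ y, lpTensor (toL2 (Pi.single y (1 : 𝕜))) (F y) := by
  refine lp_ext_count fun x => ?_
  rw [sum_lp_count_apply]
  simp [lpTensor_apply, Pi.single_apply]

/-- On a finite set every `X`-valued function is a finite sum of point masses tensored with its
values, so no density argument is needed. This identifies the abstract extension supplied by uniform
curvature with an explicit operator. -/
theorem ExtendsTensor.unique {T : Lp 𝕜 2 (Measure.count : Measure Q) →L[𝕜] Lp 𝕜 2 Measure.count}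
    {T₁ T₂ : Lp X 2 (Measure.count : Measure Q) →L[𝕜] Lp X 2 Measure.count}
    (h₁ : ExtendsTensor T T₁) (h₂ : ExtendsTensor T T₂) : T₁ = T₂ := by
  classical
  ext1 F
  rw [eq_sum_lpTensor (𝕜 := 𝕜) F, map_sum, map_sum]
  exact Finset.sum_congr rfl fun y _ => by rw [h₁, h₂]

end Functions

/-! ### Translations and their means on `L²(Q, X)` -/

section Translation

variable (𝕜 : Type*) [RCLike 𝕜] (X : Type*) [NormedAddCommGroup X] [NormedSpace 𝕜 X]
  {Q : Type*} [Group Q] [MeasurableSpace Q] [DiscreteMeasurableSpace Q]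

/-- Right translation by `a` on `L²(Q, X)`. -/
noncomputable def translateOp (a : Q) :
    Lp X 2 (Measure.count : Measure Q) →L[𝕜] Lp X 2 (Measure.count : Measure Q) :=
  (Lp.compMeasurePreservingₗᵢ 𝕜 _ (measurePreserving_mulRight_count a)).toContinuousLinearMap

/-- The mean of the right translations by the elements `φ a`, `a ∈ A`, on `L²(Q, X)`. -/
noncomputable def meanOp {α : Type*} (φ : α → Q) (A : Finset α) :
    Lp X 2 (Measure.count : Measure Q) →L[𝕜] Lp X 2 (Measure.count : Measure Q) :=
  (A.card : 𝕜)⁻¹ • ∑ a ∈ A, translateOp 𝕜 X (φ a)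

variable {𝕜 X}

theorem translateOp_apply (a : Q) (f : Lp X 2 (Measure.count : Measure Q)) (x : Q) :
    translateOp 𝕜 X a f x = f (x * a) :=
  Measure.ae_count_iff.1
    (Lp.coeFn_compMeasurePreserving f (measurePreserving_mulRight_count a)) x

theorem norm_translateOp_apply (a : Q) (f : Lp X 2 (Measure.count : Measure Q)) :
    ‖translateOp 𝕜 X a f‖ = ‖f‖ :=
  Lp.norm_compMeasurePreserving f (measurePreserving_mulRight_count a)

theorem lpBound_translateOp (p : ℝ≥0∞) (a : Q) : LpBound p 1 (translateOp 𝕜 X a) := fun f => by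
  have h : (translateOp 𝕜 X a f : Q → X) = f ∘ fun x => x * a :=
    funext fun x => translateOp_apply a f x
  rw [h, eLpNorm_comp_measurePreserving (Lp.aestronglyMeasurable f)
    (measurePreserving_mulRight_count a), one_mul]

theorem extendsTensor_translateOp (a : Q) :
    ExtendsTensor (translateOp 𝕜 𝕜 a) (translateOp 𝕜 X a) := fun f x => by
  refine lp_ext_count fun y => ?_
  simp only [translateOp_apply, lpTensor_apply]

variable {α : Type*} (φ : α → Q) {A : Finset α}

theorem extendsTensor_meanOp : ExtendsTensor (meanOp 𝕜 𝕜 φ A) (meanOp 𝕜 X φ A) :=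
  (ExtendsTensor.sum A fun a _ => extendsTensor_translateOp (φ a)).smul _

theorem lpBound_meanOp {p : ℝ≥0∞} (hp : 1 ≤ p) (hA : A.Nonempty) :
    LpBound p 1 (meanOp 𝕜 X φ A) := by
  have h := (LpBound.sum hp A fun a _ => lpBound_translateOp (𝕜 := 𝕜) (X := X) p (φ a)).smul
    (A.card : 𝕜)⁻¹
  have hA' : (A.card : ℝ≥0∞) ≠ 0 := by exact_mod_cast hA.card_pos.ne'
  have hc : (A.card : 𝕜) ≠ 0 := by exact_mod_cast hA.card_pos.ne'
  have hn : ‖(A.card : 𝕜)⁻¹‖ₑ * (A.card * 1) = 1 := by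
    have he : ‖(A.card : 𝕜)‖ₑ = A.card := by
      rw [← ofReal_norm, RCLike.norm_natCast, ENNReal.ofReal_natCast]
    rw [enorm_inv hc, he, mul_one, ENNReal.inv_mul_cancel hA' (ENNReal.natCast_ne_top _)]
  rwa [hn] at h

theorem norm_meanOp_le (hA : A.Nonempty) : ‖meanOp 𝕜 X φ A‖ ≤ 1 := by
  refine ContinuousLinearMap.opNorm_le_bound _ zero_le_one fun f => ?_
  have h := lpBound_meanOp (𝕜 := 𝕜) (X := X) φ one_le_two hA f
  rw [one_mul] at h ⊢
  exact ENNReal.toReal_mono (Lp.eLpNorm_ne_top f) h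

theorem meanOp_apply [Fintype Q] (f : Lp X 2 (Measure.count : Measure Q)) (x : Q) :
    meanOp 𝕜 X φ A f x = averageOp 𝕜 φ A f x := by
  have h : meanOp 𝕜 X φ A f = (A.card : 𝕜)⁻¹ • ∑ a ∈ A, translateOp 𝕜 X (φ a) f := by
    simp [meanOp]
  have h' : ∀ g : Lp X 2 (Measure.count : Measure Q),
      ((A.card : 𝕜)⁻¹ • g : Lp X 2 (Measure.count : Measure Q)) x = (A.card : 𝕜)⁻¹ • g x :=
    fun g => Measure.ae_count_iff.1 (Lp.coeFn_smul _ g) x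
  rw [h, h', sum_lp_count_apply, averageOp]
  simp only [translateOp_apply]

end Translation

/-! ### Means over finite normal subgroups -/

section Averaging

variable {𝕜 : Type*} [RCLike 𝕜] {X : Type*} [NormedAddCommGroup X] [NormedSpace 𝕜 X]
  {Q : Type*} [Group Q]

/-- The mean over a finite subgroup is invariant under this subgroup. -/
theorem averageOp_id_mul_right {K : Subgroup Q} {N : Finset Q} (hN : (N : Set Q) = K) (f : Q → X)
    (x : Q) {b : Q} (hb : b ∈ K) : averageOp 𝕜 id N f (x * b) = averageOp 𝕜 id N f x := by
  have hmem (a : Q) : a ∈ N ↔ a ∈ K := by rw [← Finset.mem_coe, hN, SetLike.mem_coe]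
  unfold averageOp
  congr 1
  refine Finset.sum_bij' (fun a _ => b * a) (fun a _ => b⁻¹ * a) ?_ ?_ ?_ ?_ ?_
  · exact fun a ha => (hmem _).2 (K.mul_mem hb ((hmem a).1 ha))
  · exact fun a ha => (hmem _).2 (K.mul_mem (K.inv_mem hb) ((hmem a).1 ha))
  · simp
  · simp
  · simp [mul_assoc]

/-- The mean over a finite normal subgroup commutes with translations. -/
theorem sum_mul_mul_eq_of_normal {K : Subgroup Q} [hK : K.Normal] {N : Finset Q}
    (hN : (N : Set Q) = K) (f : Q → X) (x b : Q) :
    ∑ a ∈ N, f (x * b * a) = ∑ a ∈ N, f (x * a * b) := by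
  have hmem (a : Q) : a ∈ N ↔ a ∈ K := by rw [← Finset.mem_coe, hN, SetLike.mem_coe]
  refine Finset.sum_bij' (fun a _ => b * a * b⁻¹) (fun a _ => b⁻¹ * a * b) ?_ ?_ ?_ ?_ ?_
  · exact fun a ha => (hmem _).2 (hK.conj_mem a ((hmem a).1 ha) b)
  · exact fun a ha => (hmem _).2 (by simpa using hK.conj_mem a ((hmem a).1 ha) b⁻¹)
  · simp [mul_assoc]
  · simp [mul_assoc]
  · simp [mul_assoc]

theorem averageOp_comm_of_normal {K : Subgroup Q} [K.Normal] {N : Finset Q}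
    (hN : (N : Set Q) = K) {α : Type*} (φ : α → Q) (A : Finset α) (f : Q → X) (x : Q) :
    averageOp 𝕜 φ A (averageOp 𝕜 id N f) x = averageOp 𝕜 id N (averageOp 𝕜 φ A f) x := by
  simp only [averageOp, id, ← Finset.smul_sum]
  rw [smul_comm, Finset.sum_comm (s := N)]
  simp only [sum_mul_mul_eq_of_normal hN]

theorem averageOp_id_idem {K : Subgroup Q} {N : Finset Q} (hN : (N : Set Q) = K) (f : Q → X)
    (x : Q) : averageOp 𝕜 id N (averageOp 𝕜 id N f) x = averageOp 𝕜 id N f x := by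
  have hmem (a : Q) : a ∈ N ↔ a ∈ K := by rw [← Finset.mem_coe, hN, SetLike.mem_coe]
  have hc : (N.card : 𝕜) ≠ 0 := by
    exact_mod_cast (Finset.card_pos.2 ⟨1, (hmem 1).2 K.one_mem⟩).ne'
  rw [averageOp, Finset.sum_congr rfl fun a ha =>
      averageOp_id_mul_right hN f x (b := id a) ((hmem a).1 ha),
    Finset.sum_const, ← Nat.cast_smul_eq_nsmul 𝕜, smul_smul, inv_mul_cancel₀ hc, one_smul]

variable [Fintype Q] [MeasurableSpace Q] [DiscreteMeasurableSpace Q]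

theorem commute_meanOp {K : Subgroup Q} [K.Normal] {N : Finset Q}
    (hN : (N : Set Q) = K) {α : Type*} (φ : α → Q) (A : Finset α) :
    Commute (meanOp 𝕜 X φ A) (meanOp 𝕜 X id N) := by
  refine ContinuousLinearMap.ext fun f => lp_ext_count fun x => ?_
  have h₁ : (meanOp 𝕜 X id N f : Q → X) = averageOp 𝕜 id N f := funext fun x => meanOp_apply _ _ _
  have h₂ : (meanOp 𝕜 X φ A f : Q → X) = averageOp 𝕜 φ A f := funext fun x => meanOp_apply _ _ _
  rw [mul_apply_eq_comp, mul_apply_eq_comp, meanOp_apply, meanOp_apply, h₁, h₂,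
    averageOp_comm_of_normal hN]

theorem meanOp_id_idem {K : Subgroup Q} {N : Finset Q} (hN : (N : Set Q) = K) :
    meanOp 𝕜 X id N * meanOp 𝕜 X id N = meanOp 𝕜 X id N := by
  refine ContinuousLinearMap.ext fun f => lp_ext_count fun x => ?_
  have h₁ : (meanOp 𝕜 X id N f : Q → X) = averageOp 𝕜 id N f := funext fun x => meanOp_apply _ _ _
  rw [mul_apply_eq_comp, meanOp_apply, h₁, averageOp_id_idem hN]

end Averaging

/-! ### The Poincaré inequality -/

/-- Relative Property T gives a uniform contraction of `L²(Q)` by the lazy averaging operator, on the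
functions without `q(H)`-invariant part. -/
theorem HasRelativePropertyT.exists_norm_lazy_meanOp_le {G : Type*} [Group G] {Y : Set G}
    (hT : HasRelativePropertyT G Y) {S : Finset G} (hS : Subgroup.closure (S : Set G) = ⊤)
    (hSne : S.Nonempty) (𝕜 : Type*) [RCLike 𝕜] :
    ∃ c : ℝ, 0 < c ∧ c < 1 ∧ ∀ (Q : Type) [Group Q] [Fintype Q] [MeasurableSpace Q]
      [DiscreteMeasurableSpace Q] (q : G →* Q) (N : Finset Q), N.Nonempty → (N : Set Q) = q '' Y →
      ∀ v : Lp 𝕜 2 (Measure.count : Measure Q), meanOp 𝕜 𝕜 id N v = 0 →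
        ‖((2 : 𝕜)⁻¹ • (1 + meanOp 𝕜 𝕜 q S)) v‖ ≤ c * ‖v‖ := by
  obtain ⟨δ, hδ, h⟩ := hT.exists_spectralGap S hS 𝕜
  have hk : (1 : ℝ) ≤ S.card := by exact_mod_cast hSne.card_pos
  -- Truncating `δ` at `1` keeps the number under the square root positive. Thus `0 < c`, so that
  -- `cⁿ` tends to `0` from the right, as the limit of `Δ` requires.
  have hm : 0 < min δ 1 := lt_min hδ one_pos
  have hlt : min δ 1 / (4 * S.card) ≤ 1 / 4 := by
    rw [div_le_iff₀ (by positivity)]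
    have := min_le_right δ 1
    linarith
  have hpos : 0 < min δ 1 / (4 * S.card) := by positivity
  refine ⟨√(1 - min δ 1 / (4 * S.card)), Real.sqrt_pos.2 (by linarith),
    (Real.sqrt_lt' one_pos).2 (by linarith), fun Q _ _ _ _ q N hN hNY v hv => ?_⟩
  have hv0 (x : Q) : ∑ a ∈ N, v (x * a) = 0 := by
    have h₁ : averageOp 𝕜 id N v x = 0 := by
      rw [← meanOp_apply, hv]
      exact Measure.ae_count_iff.1 (Lp.coeFn_zero 𝕜 2 _) x
    have hc : (N.card : 𝕜)⁻¹ ≠ 0 := inv_ne_zero (by exact_mod_cast hN.card_pos.ne')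
    exact (smul_eq_zero.1 h₁).resolve_left hc
  have hgap := h Q q N hN hNY v hv0
  have hnorm (s : G) : ‖translateOp 𝕜 𝕜 (q s) v - v‖ ^ 2 = ∑ x, ‖v (x * q s) - v x‖ ^ 2 := by
    rw [norm_sq_L2_count]
    refine Finset.sum_congr rfl fun x _ => ?_
    have := Measure.ae_count_iff.1 (Lp.coeFn_sub (translateOp 𝕜 𝕜 (q s) v) v) x
    rw [this, Pi.sub_apply, translateOp_apply]
  simp_rw [← norm_sq_L2_count, ← hnorm] at hgap
  have hgap' : min δ 1 * ‖v‖ ^ 2 ≤ ∑ s ∈ S, ‖translateOp 𝕜 𝕜 (q s) v - v‖ ^ 2 :=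
    le_trans (by gcongr; exact min_le_left _ _) hgap
  have hle := norm_half_add_mean_sq_le (𝕜 := 𝕜) hSne v (fun s => translateOp 𝕜 𝕜 (q s) v)
    (fun s _ => norm_translateOp_apply _ _) hgap'
  have heq : ((2 : 𝕜)⁻¹ • (1 + meanOp 𝕜 𝕜 q S)) v
      = (2 : 𝕜)⁻¹ • (v + (S.card : 𝕜)⁻¹ • ∑ s ∈ S, translateOp 𝕜 𝕜 (q s) v) := by
    simp [meanOp]
  rw [heq]
  refine le_of_sq_le_sq ?_ (by positivity)
  rwa [mul_pow, Real.sq_sqrt (by linarith)]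

/-- The Poincaré inequality in `L²(Q, X)` for a uniformly curved space `X`, uniformly over all
finite quotients `Q`. -/
theorem IsUniformlyCurved.exists_norm_meanOp_sub_le {G : Type*} [Group G] {S : Finset G}
    (hS : Subgroup.closure (S : Set G) = ⊤) (hSne : S.Nonempty) {H : Subgroup G} [H.Normal]
    (hT : HasRelativePropertyT G (H : Set G)) {𝕜 : Type*} [RCLike 𝕜] {X : Type*}
    [NormedAddCommGroup X] [NormedSpace 𝕜 X] (hX : IsUniformlyCurved 𝕜 X) :
    ∃ C : ℝ, 0 < C ∧ ∀ (Q : Type) [Group Q] [Fintype Q] [MeasurableSpace Q]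
      [DiscreteMeasurableSpace Q] (q : G →* Q), Function.Surjective q → ∀ N : Finset Q,
      (N : Set Q) = q '' (H : Set G) → ∀ f : Lp X 2 (Measure.count : Measure Q),
        ‖meanOp 𝕜 X id N f - f‖ ≤ C * ‖meanOp 𝕜 X q S f - f‖ := by
  obtain ⟨c, hc0, hc1, hc⟩ := hT.exists_norm_lazy_meanOp_le hS hSne 𝕜
  obtain ⟨Δ, hΔ, hext⟩ := hX
  -- The operator given to uniform curvature carries a factor `1 / 2`, so the bound `1 / 4` yields
  -- the `1 / 2` needed by `norm_proj_sub_le`.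
  have hev : ∀ᶠ n : ℕ in atTop, Δ (c ^ n) < 1 / 4 :=
    (hΔ.comp (tendsto_pow_atTop_nhdsWithin_zero_of_lt_one hc0 hc1)).eventually_lt_const
      (by norm_num)
  obtain ⟨n, hn, hn0⟩ := (hev.and (eventually_gt_atTop 0)).exists
  refine ⟨2 * n, by positivity, fun Q _ _ _ _ q hq N hN f => ?_⟩
  have hNK : (N : Set Q) = (H.map q : Subgroup Q) := by rw [hN, Subgroup.coe_map]
  have : (H.map q).Normal := Subgroup.Normal.map ‹_› q hq
  have hNne : N.Nonempty := ⟨1, by rw [← Finset.mem_coe, hNK]; exact one_mem _⟩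
  have hcomm : Commute ((2 : 𝕜)⁻¹ • (1 + meanOp 𝕜 𝕜 q S)) (meanOp 𝕜 𝕜 id N) :=
    ((Commute.one_left _).add_left (commute_meanOp hNK q S)).smul_left _
  have hTnorm := norm_pow_mul_one_sub_le (norm_meanOp_le (𝕜 := 𝕜) (X := 𝕜) id hNne)
    (meanOp_id_idem hNK) hcomm hc0.le (hc Q q N hNne hN) n
  have h2e : ‖(2 : 𝕜)⁻¹‖ₑ = 2⁻¹ := by
    rw [enorm_inv two_ne_zero, ← ofReal_norm, RCLike.norm_ofNat]; simp
  -- `1 - P` is only bounded by `2` on `L¹` and `L^∞`; halving makes the product contractive and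
  -- also turns the `L²` bound `2 cⁿ` into `cⁿ`.
  have hbound (p : ℝ≥0∞) (hp : 1 ≤ p) : LpBound p 1 ((2 : 𝕜)⁻¹ •
      (((2 : 𝕜)⁻¹ • (1 + meanOp 𝕜 𝕜 q S)) ^ n * (1 - meanOp 𝕜 𝕜 id N))) := by
    have hB := (LpBound.one.add hp (lpBound_meanOp (𝕜 := 𝕜) (X := 𝕜) q hp hSne)).smul (2 : 𝕜)⁻¹
    rw [h2e, one_add_one_eq_two, ENNReal.inv_mul_cancel two_ne_zero ENNReal.ofNat_ne_top] at hB
    have := ((hB.pow n).mul (LpBound.one.sub hp (lpBound_meanOp (𝕜 := 𝕜) (X := 𝕜) id hp hNne))).smul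
      (2 : 𝕜)⁻¹
    rwa [h2e, one_pow, one_mul, one_add_one_eq_two,
      ENNReal.inv_mul_cancel two_ne_zero ENNReal.ofNat_ne_top] at this
  obtain ⟨TX, hTX, hTXn⟩ := hext Q Measure.count ((2 : 𝕜)⁻¹ •
      (((2 : 𝕜)⁻¹ • (1 + meanOp 𝕜 𝕜 q S)) ^ n * (1 - meanOp 𝕜 𝕜 id N))) (c ^ n)
    (by positivity)
    (by rw [norm_smul, norm_inv, RCLike.norm_ofNat]; linarith)
    (fun f => by simpa using hbound 1 le_rfl f) (fun f => by simpa using hbound ∞ le_top f)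
  -- The same expression formed with `X`-valued means also extends the scalar operator, so
  -- uniqueness transfers the small norm to it.
  have hTX' : TX = (2 : 𝕜)⁻¹ •
      (((2 : 𝕜)⁻¹ • (1 + meanOp 𝕜 X q S)) ^ n * (1 - meanOp 𝕜 X id N)) :=
    ExtendsTensor.unique hTX ((((ExtendsTensor.one.add (extendsTensor_meanOp q)).smul _).pow n).mul
      (ExtendsTensor.one.sub (extendsTensor_meanOp id)) |>.smul _)
  rw [hTX', norm_smul, norm_inv, RCLike.norm_ofNat] at hTXn
  exact norm_proj_sub_le (norm_meanOp_le q hSne) (norm_meanOp_le id hNne) (meanOp_id_idem hNK)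
    (commute_meanOp hNK q S) (by linarith) f

/-- The operators `meanOp` and `averageOp` correspond to each other under a group isomorphism. -/
theorem norm_sq_meanOp_toL2_comp_sub {𝕜 : Type*} [RCLike 𝕜] {X : Type*} [NormedAddCommGroup X]
    [NormedSpace 𝕜 X] {Q R α : Type*} [Group Q] [Fintype Q] [Group R] [Fintype R]
    [MeasurableSpace R] [DiscreteMeasurableSpace R] (e : R ≃* Q) (φ : α → R) (A : Finset α)
    (f : Q → X) :
    ‖meanOp 𝕜 X φ A (toL2 (f ∘ e)) - toL2 (f ∘ e)‖ ^ 2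
      = ∑ g, ‖averageOp 𝕜 (e ∘ φ) A f g - f g‖ ^ 2 := by
  rw [norm_sq_L2_count, ← e.toEquiv.sum_comp]
  refine Finset.sum_congr rfl fun x _ => ?_
  have := Measure.ae_count_iff.1
    (Lp.coeFn_sub (meanOp 𝕜 X φ A (toL2 (f ∘ e))) (toL2 (f ∘ e))) x
  rw [this, Pi.sub_apply, meanOp_apply]
  simp [averageOp]

/-- The Poincaré inequality for functions on finite quotients in an arbitrary universe. -/
theorem IsUniformlyCurved.exists_sum_averageOp_sub_le.{u} {G : Type*} [Group G] {S : Finset G}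
    (hS : Subgroup.closure (S : Set G) = ⊤) (hSne : S.Nonempty) {H : Subgroup G} [H.Normal]
    (hT : HasRelativePropertyT G (H : Set G)) {𝕜 : Type*} [RCLike 𝕜] {X : Type*}
    [NormedAddCommGroup X] [NormedSpace 𝕜 X] (hX : IsUniformlyCurved 𝕜 X) :
    ∃ C : ℝ, 0 < C ∧ ∀ (Q : Type u) [Group Q] [Fintype Q] (q : G →* Q), Function.Surjective q →
      ∀ N : Finset Q, (N : Set Q) = q '' (H : Set G) → ∀ f : Q → X,
        ∑ g, ‖averageOp 𝕜 id N f g - f g‖ ^ 2 ≤ C * ∑ g, ‖averageOp 𝕜 q S f g - f g‖ ^ 2 := by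
  obtain ⟨C, hC, h⟩ := hX.exists_norm_meanOp_sub_le hS hSne hT
  refine ⟨C ^ 2, by positivity, fun Q _ _ q hq N hN f => ?_⟩
  -- Uniform curvature speaks of measure spaces in `Type`, so the finite group is replaced by an
  -- isomorphic copy there.
  let e : Shrink.{0} Q ≃* Q := Shrink.mulEquiv
  let : Fintype (Shrink.{0} Q) := Fintype.ofEquiv Q e.symm.toEquiv
  let : MeasurableSpace (Shrink.{0} Q) := ⊤
  let N' : Finset (Shrink.{0} Q) := N.map e.symm.toEquiv.toEmbedding
  have hN' : (N' : Set (Shrink.{0} Q)) = (e.symm.toMonoidHom.comp q) '' (H : Set G) := by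
    rw [Finset.coe_map, hN, Set.image_image]
    rfl
  have key := h (Shrink.{0} Q) (e.symm.toMonoidHom.comp q) (e.symm.surjective.comp hq) N' hN'
    (toL2 (f ∘ e))
  have hid : averageOp 𝕜 (e ∘ id) N' f = averageOp 𝕜 id N f := by
    ext g
    simp [averageOp, N']
  have hq' : e ∘ (e.symm.toMonoidHom.comp q) = q := by
    ext g
    simp
  have key2 := pow_le_pow_left₀ (norm_nonneg _) key 2
  rwa [mul_pow, norm_sq_meanOp_toL2_comp_sub, norm_sq_meanOp_toL2_comp_sub, hid, hq'] at key2

/-! ### Passing between means and translations -/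

/-- Cauchy–Schwarz gives this with an extra factor `1 / |A| ≤ 1`, which is dropped. -/
theorem norm_averageOp_sub_sq_le {𝕜 : Type*} [RCLike 𝕜] {X : Type*} [NormedAddCommGroup X]
    [NormedSpace 𝕜 X] {Q α : Type*} [Group Q] (φ : α → Q) {A : Finset α} (hA : A.Nonempty)
    (f : Q → X) (g : Q) :
    ‖averageOp 𝕜 φ A f g - f g‖ ^ 2 ≤ ∑ a ∈ A, ‖f (g * φ a) - f g‖ ^ 2 := by
  have hk : (1 : ℝ) ≤ A.card := by exact_mod_cast hA.card_pos
  have hk' : (A.card : 𝕜) ≠ 0 := by exact_mod_cast hA.card_pos.ne'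
  have heq : averageOp 𝕜 φ A f g - f g = (A.card : 𝕜)⁻¹ • ∑ a ∈ A, (f (g * φ a) - f g) := by
    rw [Finset.sum_sub_distrib, Finset.sum_const, ← Nat.cast_smul_eq_nsmul 𝕜, smul_sub,
      smul_smul, inv_mul_cancel₀ hk', one_smul, averageOp]
  have hsq : ‖∑ a ∈ A, (f (g * φ a) - f g)‖ ^ 2 ≤ A.card * ∑ a ∈ A, ‖f (g * φ a) - f g‖ ^ 2 :=
    (pow_le_pow_left₀ (norm_nonneg _) (norm_sum_le _ _) 2).trans sq_sum_le_card_mul_sum_sq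
  rw [heq, norm_smul, norm_inv, RCLike.norm_natCast, mul_pow]
  calc ((A.card : ℝ)⁻¹) ^ 2 * ‖∑ a ∈ A, (f (g * φ a) - f g)‖ ^ 2
      ≤ ((A.card : ℝ)⁻¹) ^ 2 * (A.card * ∑ a ∈ A, ‖f (g * φ a) - f g‖ ^ 2) := by gcongr
    _ = (A.card : ℝ)⁻¹ * ∑ a ∈ A, ‖f (g * φ a) - f g‖ ^ 2 := by field_simp
    _ ≤ 1 * ∑ a ∈ A, ‖f (g * φ a) - f g‖ ^ 2 := by gcongr; exact inv_le_one_of_one_le₀ hk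
    _ = _ := one_mul _

/-- A translation by an element of a finite subgroup moves `f` at most twice as far as the mean over
this subgroup does. -/
theorem sum_norm_translate_sub_sq_le (𝕜 : Type*) [RCLike 𝕜] {X : Type*} [NormedAddCommGroup X]
    [NormedSpace 𝕜 X] {Q : Type*} [Group Q] [Fintype Q] {K : Subgroup Q} {N : Finset Q}
    (hN : (N : Set Q) = K) (f : Q → X) {b : Q} (hb : b ∈ K) :
    ∑ g, ‖f (g * b) - f g‖ ^ 2 ≤ 4 * ∑ g, ‖averageOp 𝕜 id N f g - f g‖ ^ 2 := by
  set F : Q → ℝ := fun g => ‖averageOp 𝕜 id N f g - f g‖ with hF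
  have hshift : ∑ g, F (g * b) ^ 2 = ∑ g, F g ^ 2 :=
    Equiv.sum_comp (Equiv.mulRight b) fun g => F g ^ 2
  -- The mean takes the same value at `g` and `g * b`, so it serves as a common intermediate point;
  -- summing the two distances costs the factor `4`.
  have hpt (g : Q) : ‖f (g * b) - f g‖ ^ 2 ≤ 2 * (F (g * b) ^ 2 + F g ^ 2) := by
    have h : ‖f (g * b) - f g‖ ≤ F (g * b) + F g := by
      have hFb : F (g * b) = ‖f (g * b) - averageOp 𝕜 id N f g‖ := by
        simp only [hF, averageOp_id_mul_right hN f g hb, norm_sub_rev]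
      rw [hFb]
      exact norm_sub_le_norm_sub_add_norm_sub _ _ _
    exact (pow_le_pow_left₀ (norm_nonneg _) h 2).trans add_sq_le
  calc ∑ g, ‖f (g * b) - f g‖ ^ 2 ≤ ∑ g, 2 * (F (g * b) ^ 2 + F g ^ 2) :=
        Finset.sum_le_sum fun g _ => hpt g
    _ = 4 * ∑ g, F g ^ 2 := by
        rw [← Finset.mul_sum, Finset.sum_add_distrib, hshift]; ring

theorem mainTheorem6 {G : Type*} [Group G]
    (S : Finset G) (hSsymm : ∀ s ∈ S, s⁻¹ ∈ S) (hSgen : Subgroup.closure (S : Set G) = ⊤)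
    (H : Subgroup G) [H.Normal] (hT : HasRelativePropertyT G (H : Set G))
    {𝕜 : Type*} [RCLike 𝕜]
    {X : Type*} [NormedAddCommGroup X] [NormedSpace 𝕜 X] [CompleteSpace X]
    (hX : IsUniformlyCurved 𝕜 X) :
    ∃ (C : ℝ) (n₀ : ℕ), 0 < C ∧ 1 ≤ n₀ ∧
      ∀ (Q : Type*) [Group Q] [Fintype Q] (q : G →* Q), Function.Surjective q →
        ∀ f : Q → X,
          (∑ g : Q, ‖averageOp 𝕜 id (Set.toFinite (q '' (H : Set G))).toFinset f g - f g‖ ^ 2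
              ≤ C * ∑ g : Q, ‖(averageOp 𝕜 q S)^[n₀] f g - f g‖ ^ 2) ∧
          ∀ h ∈ H,
            ∑ g : Q, ‖f (g * q h) - f g‖ ^ 2
              ≤ (2 * (n₀ : ℝ)) ^ 2 * C * ∑ g : Q, ∑ s ∈ S, ‖f (g * q s) - f g‖ ^ 2 := by
  rcases S.eq_empty_or_nonempty with rfl | hSne
  -- If `S` is empty, `averageOp` over `S` is zero by the convention `0⁻¹ = 0`, but `G` is trivial
  -- and both left-hand sides vanish.
  · have htriv (g : G) : g = 1 := by
      have : g ∈ Subgroup.closure ((∅ : Finset G) : Set G) := hSgen ▸ Subgroup.mem_top g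
      simpa using this
    refine ⟨1, 1, one_pos, le_rfl, fun Q _ _ q hq f => ⟨?_, fun h _ => ?_⟩⟩
    · have hQ (a : Q) : a = 1 := by
        obtain ⟨g, rfl⟩ := hq a
        rw [htriv g, map_one]
      have hN : (Set.toFinite (q '' (H : Set G))).toFinset = {1} := by
        ext a
        simp only [Set.Finite.mem_toFinset, Finset.mem_singleton, hQ a, iff_true]
        exact ⟨1, H.one_mem, map_one q⟩
      have hz (g : Q) : averageOp 𝕜 id {1} f g - f g = 0 := by simp [averageOp]
      simp only [hN, hz, norm_zero, one_mul]
      rw [zero_pow two_ne_zero, Finset.sum_const_zero]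
      positivity
    · simp [htriv h]
  · obtain ⟨C, hC, hpoin⟩ := hX.exists_sum_averageOp_sub_le hSgen hSne hT
    -- `‖M_Sⁿ f - f‖ ≤ n ‖M_S f - f‖`, and for even `n` the inequality fails when `S` consists of
    -- odd elements for some sign character nontrivial on `H`: hence the exponent `1`, with the
    -- power of the lazy operator `(1 + M_S) / 2` that uniform curvature requires absorbed in `C`.
    refine ⟨C, 1, hC, le_rfl, fun Q _ _ q hq f => ?_⟩
    have hfirst := hpoin Q q hq (Set.toFinite (q '' (H : Set G))).toFinset (by simp) f
    refine ⟨by simpa using hfirst, fun h hh => ?_⟩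
    have hK : ((Set.toFinite (q '' (H : Set G))).toFinset : Set Q) = (H.map q : Subgroup Q) := by
      simp
    -- The factor `4` from comparing a translation with the mean is exactly `(2 n₀)²` for `n₀ = 1`.
    calc ∑ g, ‖f (g * q h) - f g‖ ^ 2
        ≤ 4 * ∑ g, ‖averageOp 𝕜 id (Set.toFinite (q '' (H : Set G))).toFinset f g - f g‖ ^ 2 :=
          sum_norm_translate_sub_sq_le 𝕜 hK f (Subgroup.mem_map_of_mem q hh)
      _ ≤ 4 * (C * ∑ g, ‖averageOp 𝕜 q S f g - f g‖ ^ 2) := by gcongr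
      _ ≤ 4 * (C * ∑ g, ∑ s ∈ S, ‖f (g * q s) - f g‖ ^ 2) := by
          gcongr with g
          exact norm_averageOp_sub_sq_le q hSne f g
      _ = (2 * ((1 : ℕ) : ℝ)) ^ 2 * C * ∑ g, ∑ s ∈ S, ‖f (g * q s) - f g‖ ^ 2 := by
          push_cast; ring
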